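/- Let $f:\mathbb{R}^d\to\mathbb{R}$ be a skew-Gaussian process $\mathrm{SkewGP}_s(\xi,\Omega,\Delta,\gamma,\Gamma)$ with location function $\xi:\mathbb{R}^d\to\mathbb{R}$, scale function (kernel) $\Omega:\mathbb{R}^d\times\mathbb{R}^d\to\mathbb{R}$, skewness function $\Delta:\mathbb{R}^d\to\mathbb{R}^s$ and parameters $\gamma\in\mathbb{R}^s$, $\Gamma\in\mathbb{R}^{s\times s}$. This means that for any finite set of distinct points $X=\{x_1,\dots,x_n\}\subset\mathbb{R}^d$, with $\xi(X)=(\xi(x_i))_i\in\mathbb{R}^n$, $\Omega(X,X)=(\Omega(x_i,x_j))_{i,j}\in\mathbb{R}^{n\times n}$ and $\Delta(X)\in\mathbb{R}^{n\times s}$ with rows $\Delta(x_i)^T$, the matrix $\begin{bmatrix}\Gamma&\Delta(X)^T\\ \Delta(X)&\bar\Omega(X,X)\end{bmatrix}$ is positive definite and $f(X)=(f(x_1),\dots,f(x_n))$ has on $\mathbb{R}^n$ the unified skew-normal density $$\phi_n(z-\xi;\Omega)\,\frac{\Phi_s\big(\gamma+\Delta^T\bar\Omega^{-1}D_\Omega^{-1}(z-\xi);\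 \Gamma-\Delta^T\bar\Omega^{-1}\Delta\big)}{\Phi_s(\gamma;\Gamma)},\qquad \xi=\xi(X),\ \Omega=\Omega(X,X),\ \Delta=\Delta(X).$$ Here $\phi_k(\cdot;M)$ and $\Phi_k(\cdot;M)$ are the density and the cumulative distribution function of the $k$-variate normal distribution with mean $0$ and covariance matrix $M$ ($\phi_0=\Phi_0=1$), and for a square matrix $A$, $D_A$ is the diagonal matrix of the square roots of the diagonal entries of $A$ and $\bar A=D_A^{-1}AD_A^{-1}$. Fix distinct points $X=\{x_1,\dots,x_n\}$, matrices $C\in\mathbb{R}^{m_r\times n}$, $W\in\mathbb{R}^{m_a\times n}$, vectors $Y\in\mathbb{R}^{m_r}$, $Z\in\mathbb{R}^{m_a}$ and symmetric positive definite matrices $R\in\mathbb{R}^{m_r\times m_r}$, $\Sigma\in\mathbb{R}^{m_a\times m_a}$, and consider the mixed likelihood $$p(Y,Z,W\mid f(X))=\Phi_{m_a}(Z+Wf(X);\Sigma)\,\phi_{m_r}(Y-Cf(X);R).$$ Write $\xi=\xi(X)$, $\Omega=\Omega(X,X)$, $\Delta=\Delta(X)$, and put $$\tilde\xi=\xi+\Omega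 C^T(C\Omega C^T+R)^{-1}(Y-C\xi),\qquad \tilde\Omega=\Omega-\Omega C^T(C\Omega C^T+R)^{-1}C\Omega,$$ $$\Delta_*=\begin{bmatrix}\Delta & D_\Omega^{-1}\Omega W^T\end{bmatrix},\qquad \gamma_p=\begin{bmatrix}\gamma\\ Z+W\xi\end{bmatrix},\qquad \Gamma_p=\begin{bmatrix}\Gamma&\Delta^TD_\Omega W^T\\ WD_\Omega\Delta& W\Omega W^T+\Sigma\end{bmatrix},$$ $$\Delta_p=\bar{\tilde\Omega}\,D_{\tilde\Omega}\,D_\Omega^{-1}\,\bar\Omega^{-1}\Delta_*,$$ $$\tilde\gamma=\gamma_p+\Delta_*^T\bar\Omega^{-1}D_\Omega^{-1}(\tilde\xi-\xi),\qquad \tilde\Gamma=\Gamma_p-\Delta_*^T\bar\Omega^{-1}\Delta_*+\Delta_p^T\,\bar{\tilde\Omega}^{-1}\Delta_p.$$ Then the likelihood is integrable under the prior and the marginal likelihood of the observations, i.e. the integral of $p(Y,Z,W\mid f(X))$ over the prior distribution of $f(X)$, equals $$p(Y)=\phi_{m_r}\big(Y-C\xi;\ C\Omega C^T+R\big)\,\frac{\Phi_{s+m_a}(\tilde\gamma;\tilde\Gamma)}{\Phi_s(\gamma;\Gamma)}.$$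 -/

import Mathlib

open MeasureTheory Matrix

noncomputable section

namespace SkewGP

section Gaussian

variable {ι : Type*} [Fintype ι] [DecidableEq ι]

/-- `φ(x; M)`: the density at `x`, with respect to Lebesgue measure on `ι → ℝ`, of the centred
normal distribution with (positive definite) covariance matrix `M`. -/
def normalPdf (M : Matrix ι ι ℝ) (x : ι → ℝ) : ℝ :=
  (Real.sqrt ((2 * Real.pi) ^ Fintype.card ι * M.det))⁻¹ *
    Real.exp (-(x ⬝ᵥ (M⁻¹ *ᵥ x)) / 2)

/-- `Φ(a; M)`: the cumulative distribution function at `a` of the centred normal distribution with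
(positive definite) covariance matrix `M`, i.e. the integral of `φ(t; M)` over all `t ≤ a`
(coordinatewise). It equals `1` if `ι` is empty. -/
def normalCdf (M : Matrix ι ι ℝ) (a : ι → ℝ) : ℝ :=
  ∫ t in Set.Iic a, normalPdf M t

/-- `D_Ω`: the diagonal matrix of the square roots of the diagonal entries of `Ω`. -/
def scaleDiag (Ω : Matrix ι ι ℝ) : Matrix ι ι ℝ :=
  Matrix.diagonal fun i => Real.sqrt (Ω i i)

/-- `Ω̄ = D_Ω⁻¹ Ω D_Ω⁻¹`: the correlation matrix of `Ω`. -/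
def corr (Ω : Matrix ι ι ℝ) : Matrix ι ι ℝ :=
  (scaleDiag Ω)⁻¹ * Ω * (scaleDiag Ω)⁻¹

end Gaussian

section SUN

variable {p s : ℕ}

/-- The density of the unified skew-normal distribution `SUN_{p,s}(ξ, Ω, Δ, γ, Γ)`. -/
def sunPdf (ξ : Fin p → ℝ) (Ω : Matrix (Fin p) (Fin p) ℝ) (Δ : Matrix (Fin p) (Fin s) ℝ)
    (γ : Fin s → ℝ) (Γ : Matrix (Fin s) (Fin s) ℝ) (z : Fin p → ℝ) : ℝ :=
  normalPdf Ω (z - ξ) *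
    (normalCdf (Γ - Δᵀ * (corr Ω)⁻¹ * Δ)
        (γ + (Δᵀ * (corr Ω)⁻¹ * (scaleDiag Ω)⁻¹) *ᵥ (z - ξ)) /
      normalCdf Γ γ)

/-- The unified skew-normal distribution as a measure on `ℝᵖ`. -/
def sunMeasure (ξ : Fin p → ℝ) (Ω : Matrix (Fin p) (Fin p) ℝ) (Δ : Matrix (Fin p) (Fin s) ℝ)
    (γ : Fin s → ℝ) (Γ : Matrix (Fin s) (Fin s) ℝ) : Measure (Fin p → ℝ) :=
  volume.withDensity fun z => ENNReal.ofReal (sunPdf ξ Ω Δ γ Γ z)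

end SUN

section Proc

variable {E : Type*} {n s : ℕ}

/-- `ξ(X)`. -/
def locVec (ξ : E → ℝ) (X : Fin n → E) : Fin n → ℝ := fun i => ξ (X i)

/-- `Ω(X, X)`. -/
def scaleMat (Ω : E → E → ℝ) (X : Fin n → E) : Matrix (Fin n) (Fin n) ℝ :=
  Matrix.of fun i j => Ω (X i) (X j)

/-- `Δ(X)`, as an `n × s` matrix whose `i`-th row is `Δ(xᵢ)`. -/
def skewMat (Δ : E → Fin s → ℝ) (X : Fin n → E) : Matrix (Fin n) (Fin s) ℝ :=
  Matrix.of fun i k => Δ (X i) k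

/-- The real-valued process `f` on `E` is a skew-Gaussian process
`SkewGP_s(ξ, Ω, Δ, γ, Γ)` under `P`: for every finite family `X` of distinct points the parameter
matrix is positive definite, and the vector `(f(x₁), …, f(xₙ))` has the distribution
`SUN_{n,s}(ξ(X), Ω(X,X), Δ(X), γ, Γ)`. -/
structure IsSkewGP {Θ : Type*} [MeasurableSpace Θ] (P : Measure Θ) (f : E → Θ → ℝ)
    (ξ : E → ℝ) (Ω : E → E → ℝ) (Δ : E → Fin s → ℝ)
    (γ : Fin s → ℝ) (Γ : Matrix (Fin s) (Fin s) ℝ) : Prop where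
  measurable : ∀ x, Measurable (f x)
  posDef : ∀ (n : ℕ) (X : Fin n → E), Function.Injective X →
    (Matrix.fromBlocks Γ (skewMat Δ X)ᵀ (skewMat Δ X) (corr (scaleMat Ω X))).PosDef
  law : ∀ (n : ℕ) (X : Fin n → E), Function.Injective X →
    P.map (fun θ i => f (X i) θ) =
      sunMeasure (locVec ξ X) (scaleMat Ω X) (skewMat Δ X) γ Γ

end Proc

section Mixed

variable {n s mr ma : ℕ}

/-- The mixed likelihood `p(Y, Z, W ∣ v) = Φ_{mₐ}(Z + W v; S) φ_{mᵣ}(Y - C v; R)` of the vector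
`v = f(X)`. -/
def mixedLikelihood (C : Matrix (Fin mr) (Fin n) ℝ) (R : Matrix (Fin mr) (Fin mr) ℝ)
    (Y : Fin mr → ℝ) (W : Matrix (Fin ma) (Fin n) ℝ) (Z : Fin ma → ℝ)
    (S : Matrix (Fin ma) (Fin ma) ℝ) (v : Fin n → ℝ) : ℝ :=
  normalCdf S (Z + W *ᵥ v) * normalPdf R (Y - C *ᵥ v)

/-- The marginal likelihood: the likelihood, as a function `L` of `f(X)`, integrated over the
distribution of `f(X)` under the prior. -/
def marginalLikelihood {E Θ : Type*} [MeasurableSpace Θ] (P : Measure Θ) (f : E → Θ → ℝ)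
    (X : Fin n → E) (L : (Fin n → ℝ) → ℝ) : ℝ :=
  ∫ θ, L (fun i => f (X i) θ) ∂P

/-- `ξ̃(X) = ξ + Ω Cᵀ (C Ω Cᵀ + R)⁻¹ (Y - C ξ)`. -/
def postLoc (ξ : Fin n → ℝ) (Ω : Matrix (Fin n) (Fin n) ℝ) (C : Matrix (Fin mr) (Fin n) ℝ)
    (R : Matrix (Fin mr) (Fin mr) ℝ) (Y : Fin mr → ℝ) : Fin n → ℝ :=
  ξ + (Ω * Cᵀ * (C * Ω * Cᵀ + R)⁻¹) *ᵥ (Y - C *ᵥ ξ)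

/-- `Ω̃(X,X) = Ω - Ω Cᵀ (C Ω Cᵀ + R)⁻¹ C Ω`. -/
def postScale (Ω : Matrix (Fin n) (Fin n) ℝ) (C : Matrix (Fin mr) (Fin n) ℝ)
    (R : Matrix (Fin mr) (Fin mr) ℝ) : Matrix (Fin n) (Fin n) ℝ :=
  Ω - Ω * Cᵀ * (C * Ω * Cᵀ + R)⁻¹ * C * Ω

/-- `Δ_* = [Δ, D_Ω⁻¹ Ω Wᵀ]`, an `n × (s + mₐ)` matrix. -/
def augSkew (Ω : Matrix (Fin n) (Fin n) ℝ) (Δ : Matrix (Fin n) (Fin s) ℝ)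
    (W : Matrix (Fin ma) (Fin n) ℝ) : Matrix (Fin n) (Fin s ⊕ Fin ma) ℝ :=
  Matrix.fromCols Δ ((scaleDiag Ω)⁻¹ * Ω * Wᵀ)

/-- `γ_p = [γ, Z + W ξ]`. -/
def affineGammaVec (ξ : Fin n → ℝ) (γ : Fin s → ℝ) (W : Matrix (Fin ma) (Fin n) ℝ)
    (Z : Fin ma → ℝ) : Fin s ⊕ Fin ma → ℝ :=
  Sum.elim γ (Z + W *ᵥ ξ)

/-- `Γ_p = [[Γ, Δᵀ D_Ω Wᵀ], [W D_Ω Δ, W Ω Wᵀ + S]]`. -/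
def affineGammaMat (Ω : Matrix (Fin n) (Fin n) ℝ) (Δ : Matrix (Fin n) (Fin s) ℝ)
    (Γ : Matrix (Fin s) (Fin s) ℝ) (W : Matrix (Fin ma) (Fin n) ℝ)
    (S : Matrix (Fin ma) (Fin ma) ℝ) : Matrix (Fin s ⊕ Fin ma) (Fin s ⊕ Fin ma) ℝ :=
  Matrix.fromBlocks Γ (Δᵀ * scaleDiag Ω * Wᵀ) (W * scaleDiag Ω * Δ) (W * Ω * Wᵀ + S)

/-- `Δ_p = corr(Ω̃) D_Ω̃ D_Ω⁻¹ Ω̄⁻¹ Δ_*`. -/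
def postSkew (Ω : Matrix (Fin n) (Fin n) ℝ) (Δ : Matrix (Fin n) (Fin s) ℝ)
    (C : Matrix (Fin mr) (Fin n) ℝ) (R : Matrix (Fin mr) (Fin mr) ℝ)
    (W : Matrix (Fin ma) (Fin n) ℝ) : Matrix (Fin n) (Fin s ⊕ Fin ma) ℝ :=
  corr (postScale Ω C R) * scaleDiag (postScale Ω C R) * (scaleDiag Ω)⁻¹ * (corr Ω)⁻¹ *
    augSkew Ω Δ W

/-- `γ̃ = γ_p + Δ_*ᵀ Ω̄⁻¹ D_Ω⁻¹ (ξ̃ - ξ)`. -/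
def postGammaVec (ξ : Fin n → ℝ) (Ω : Matrix (Fin n) (Fin n) ℝ) (Δ : Matrix (Fin n) (Fin s) ℝ)
    (γ : Fin s → ℝ) (C : Matrix (Fin mr) (Fin n) ℝ) (R : Matrix (Fin mr) (Fin mr) ℝ)
    (Y : Fin mr → ℝ) (W : Matrix (Fin ma) (Fin n) ℝ) (Z : Fin ma → ℝ) : Fin s ⊕ Fin ma → ℝ :=
  affineGammaVec ξ γ W Z +
    ((augSkew Ω Δ W)ᵀ * (corr Ω)⁻¹ * (scaleDiag Ω)⁻¹) *ᵥ (postLoc ξ Ω C R Y - ξ)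

/-- `Γ̃ = Γ_p - Δ_*ᵀ Ω̄⁻¹ Δ_* + Δ_pᵀ corr(Ω̃)⁻¹ Δ_p`. -/
def postGammaMat (Ω : Matrix (Fin n) (Fin n) ℝ) (Δ : Matrix (Fin n) (Fin s) ℝ)
    (Γ : Matrix (Fin s) (Fin s) ℝ) (C : Matrix (Fin mr) (Fin n) ℝ)
    (R : Matrix (Fin mr) (Fin mr) ℝ) (W : Matrix (Fin ma) (Fin n) ℝ)
    (S : Matrix (Fin ma) (Fin ma) ℝ) : Matrix (Fin s ⊕ Fin ma) (Fin s ⊕ Fin ma) ℝ :=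
  affineGammaMat Ω Δ Γ W S - (augSkew Ω Δ W)ᵀ * (corr Ω)⁻¹ * augSkew Ω Δ W +
    (postSkew Ω Δ C R W)ᵀ * (corr (postScale Ω C R))⁻¹ * postSkew Ω Δ C R W

end Mixed

end SkewGP

end

/-! The argument is Gaussian conjugacy followed by one averaging identity. Prior density times
likelihood has two Gaussian factors in `z`, and by `normalPdf_mul_normalPdf` they recombine as φ(Y -
Cξ; CΩCᵀ + R) φ(z - ξ̃; Ω̃). The two distribution functions merge into a single one with block
diagonal covariance M = diag(Γ - ΔᵀΩ̄⁻¹Δ, S), evaluated at γ̃ + B(z - ξ̃), where B stacks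
ΔᵀΩ̄⁻¹D_Ω⁻¹ over W.

If z ~ N(0, V) and T ~ N(0, M) are independent, then Φ(a + Bz; M) is the conditional probability of
T - Bz ≤ a, so its mean is Φ(a; BVBᵀ + M); this is `integral_normalPdf_mul_normalCdf`, used with V =
Ω̃. Matrix algebra gives B = Δ_*ᵀΩ̄⁻¹D_Ω⁻¹, M = Γ_p - Δ_*ᵀΩ̄⁻¹Δ_* and BΩ̃Bᵀ = Δ_pᵀ corr(Ω̃)⁻¹ Δ_p,
hence BΩ̃Bᵀ + M = Γ̃ (`postGammaMat_eq`). -/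

namespace SkewGP

/-! ### Normal densities and distribution functions -/

section Gaussian

variable {ι κ : Type*} [Fintype ι] [DecidableEq ι] [Fintype κ] [DecidableEq κ]

lemma normalPdf_nonneg (M : Matrix ι ι ℝ) (x : ι → ℝ) : 0 ≤ normalPdf M x := by
  unfold normalPdf; positivity

lemma normalCdf_nonneg (M : Matrix ι ι ℝ) (a : ι → ℝ) : 0 ≤ normalCdf M a :=
  integral_nonneg fun _ => normalPdf_nonneg M _

lemma continuous_normalPdf (M : Matrix ι ι ℝ) : Continuous (normalPdf M) := by
  unfold normalPdf
  fun_prop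

open scoped MatrixOrder Matrix.Norms.L2Operator in
lemma exists_inv_eq_transpose_mul_self {M : Matrix ι ι ℝ} (hM : M.PosDef) :
    ∃ B : Matrix ι ι ℝ, B.det ≠ 0 ∧ M⁻¹ = Bᵀ * B := by
  obtain ⟨B, hB, h⟩ := CStarAlgebra.isStrictlyPositive_iff_eq_star_mul_self.mp
    hM.inv.isStrictlyPositive
  exact ⟨B, ((isUnit_iff_isUnit_det _).mp hB).ne_zero, h⟩

omit [DecidableEq ι] in
lemma integrable_and_integral_exp_neg_dotProduct_self :
    Integrable (fun x : ι → ℝ => Real.exp (-(x ⬝ᵥ x) / 2)) ∧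
      ∫ x : ι → ℝ, Real.exp (-(x ⬝ᵥ x) / 2) = Real.sqrt (2 * Real.pi) ^ Fintype.card ι := by
  have h : (fun x : ι → ℝ => Real.exp (-(x ⬝ᵥ x) / 2)) =
      fun x => ∏ i, Real.exp (-(1 / 2) * x i ^ 2) := by
    funext x
    rw [← Real.exp_sum]
    congr 1
    simp only [dotProduct, ← Finset.mul_sum, sq]
    ring
  rw [h]
  refine ⟨Integrable.fintype_prod fun i => integrable_exp_neg_mul_sq (by norm_num), ?_⟩
  rw [integral_fintype_prod_volume_eq_pow (fun y : ℝ => Real.exp (-(1 / 2) * y ^ 2)),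
    integral_gaussian]
  congr 2
  ring

/-- With M⁻¹ = BᵀB, the substitution y = Bx reduces to the standard Gaussian, and the Jacobian |det
B|⁻¹ cancels the factor √(det M) of the normalization. -/
lemma integrable_and_integral_normalPdf {M : Matrix ι ι ℝ} (hM : M.PosDef) :
    Integrable (normalPdf M) ∧ ∫ x, normalPdf M x = 1 := by
  obtain ⟨B, hB, hMB⟩ := exists_inv_eq_transpose_mul_self hM
  have hdet : M.det = (B.det ^ 2)⁻¹ := by
    have := congrArg Matrix.det hMB
    rw [det_mul, det_transpose, det_nonsing_inv, Ring.inverse_eq_inv'] at this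
    rw [sq, ← this, inv_inv]
  obtain ⟨hint, hval⟩ := integrable_and_integral_exp_neg_dotProduct_self (ι := ι)
  have hfun : normalPdf M = fun x => (Real.sqrt ((2 * Real.pi) ^ Fintype.card ι * M.det))⁻¹ *
      (fun y : ι → ℝ => Real.exp (-(y ⬝ᵥ y) / 2)) (toLin' B x) := by
    funext x
    simp only [normalPdf, hMB, toLin'_apply]
    rw [← mulVec_mulVec, dotProduct_mulVec, vecMul_transpose]
  have hmap := Real.map_matrix_volume_pi_eq_smul_volume_pi hB
  have hmeas : Measurable (toLin' B) := (LinearMap.continuous_of_finiteDimensional _).measurable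
  have hint' : Integrable (fun y : ι → ℝ => Real.exp (-(y ⬝ᵥ y) / 2))
      (Measure.map (toLin' B) volume) := by
    rw [hmap]
    exact hint.smul_measure ENNReal.ofReal_ne_top
  rw [hfun]
  refine ⟨(hint'.comp_measurable hmeas).const_mul _, ?_⟩
  rw [integral_const_mul,
    ← integral_map (φ := toLin' B) (f := fun y : ι → ℝ => Real.exp (-(y ⬝ᵥ y) / 2))
      hmeas.aemeasurable hint'.aestronglyMeasurable, hmap, integral_smul_measure, hval, hdet,
    Real.sqrt_mul (by positivity), Real.sqrt_inv, Real.sqrt_sq_eq_abs, Real.sqrt_eq_rpow,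
    Real.sqrt_eq_rpow, ENNReal.toReal_ofReal (abs_nonneg _), ← Real.rpow_natCast,
    ← Real.rpow_natCast, ← Real.rpow_mul (by positivity), ← Real.rpow_mul (by positivity),
    mul_comm (1 / 2 : ℝ), abs_inv, smul_eq_mul]
  have h1 : (2 * Real.pi) ^ ((Fintype.card ι : ℝ) * (1 / 2)) ≠ 0 :=
    (Real.rpow_pos_of_pos (by positivity) _).ne'
  have h2 : |B.det| ≠ 0 := abs_ne_zero.mpr hB
  field_simp

lemma normalCdf_le_one {M : Matrix ι ι ℝ} (hM : M.PosDef) (a : ι → ℝ) : normalCdf M a ≤ 1 := by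
  obtain ⟨hint, hval⟩ := integrable_and_integral_normalPdf hM
  rw [← hval]
  exact setIntegral_le_integral hint (.of_forall (normalPdf_nonneg M))

lemma measurable_normalCdf (M : Matrix ι ι ℝ) : Measurable (normalCdf M) := by
  -- The moving domain t ≤ a becomes a jointly measurable indicator, so measurability in `a` is that
  -- of a parametric integral.
  have hs : MeasurableSet {p : (ι → ℝ) × (ι → ℝ) | p.2 ≤ p.1} :=
    (isClosed_le continuous_snd continuous_fst).measurableSet
  have h : StronglyMeasurable
      ({p : (ι → ℝ) × (ι → ℝ) | p.2 ≤ p.1}.indicator fun p => normalPdf M p.2) :=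
    ((continuous_normalPdf M).measurable.comp measurable_snd).stronglyMeasurable.indicator hs
  convert! (h.integral_prod_right' (ν := volume)).measurable using 1
  funext a
  rw [normalCdf, ← integral_indicator measurableSet_Iic]
  rfl

lemma normalPdf_le {M : Matrix ι ι ℝ} (hM : M.PosDef) (x : ι → ℝ) :
    normalPdf M x ≤ (Real.sqrt ((2 * Real.pi) ^ Fintype.card ι * M.det))⁻¹ := by
  refine mul_le_of_le_one_right (by positivity) (Real.exp_le_one_iff.mpr ?_)
  have := hM.inv.posSemidef.dotProduct_mulVec_nonneg x
  simp only [star_trivial] at this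
  linarith

/-- The normal distribution function of a block diagonal covariance matrix factorizes. -/
lemma normalCdf_fromBlocks (A : Matrix ι ι ℝ) (D : Matrix κ κ ℝ) (hA : A.PosDef) (hD : D.PosDef)
    (a : ι → ℝ) (b : κ → ℝ) :
    normalCdf (fromBlocks A 0 0 D) (Sum.elim a b) = normalCdf A a * normalCdf D b := by
  have hpdf : ∀ (x : ι → ℝ) (y : κ → ℝ),
      normalPdf (fromBlocks A 0 0 D) (Sum.elim x y) = normalPdf A x * normalPdf D y := by
    intro x y
    let := hA.isUnit.invertible
    let := hD.isUnit.invertible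
    have hinv : (fromBlocks A 0 0 D)⁻¹ = fromBlocks A⁻¹ 0 0 D⁻¹ := by
      refine inv_eq_right_inv ?_
      simp [fromBlocks_multiply]
    unfold normalPdf
    rw [hinv, det_fromBlocks_zero₂₁, Fintype.card_sum, pow_add, fromBlocks_mulVec,
      Sum.elim_comp_inl, Sum.elim_comp_inr, sumElim_dotProduct_sumElim]
    simp only [zero_mulVec, add_zero, zero_add]
    rw [neg_add, add_div, Real.exp_add, mul_mul_mul_comm ((2 * Real.pi) ^ _),
      Real.sqrt_mul (mul_nonneg (by positivity) hA.det_pos.le), mul_inv]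
    ring
  have hpre : (MeasurableEquiv.sumPiEquivProdPi fun _ : ι ⊕ κ => ℝ).symm ⁻¹' Set.Iic (Sum.elim a b)
      = Set.Iic a ×ˢ Set.Iic b := by
    ext ⟨x, y⟩
    simp only [Set.mem_preimage, Set.mem_Iic, Set.mem_prod, Pi.le_def, Sum.forall]
    rfl
  unfold normalCdf
  rw [← (volume_measurePreserving_sumPiEquivProdPi_symm fun _ : ι ⊕ κ =>
    ℝ).setIntegral_preimage_emb (MeasurableEquiv.measurableEmbedding _), hpre,
    ← setIntegral_prod_mul]
  refine integral_congr_ae (.of_forall fun p => ?_)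
  simp only [← hpdf]
  congr 1

end Gaussian

/-! ### Gaussian conditioning and averaging -/

section Conditioning

variable {ι κ : Type*} [Fintype ι] [DecidableEq ι] [Fintype κ] [DecidableEq κ]

omit [DecidableEq ι] [DecidableEq κ] in
lemma posDef_mul_mul_transpose_add {V : Matrix ι ι ℝ} (hV : V.PosDef) {R : Matrix κ κ ℝ}
    (hR : R.PosDef) (C : Matrix κ ι ℝ) : (C * V * Cᵀ + R).PosDef :=
  .posSemidef_add (hV.posSemidef.mul_mul_conjTranspose_same C) hR

lemma posDef_inv_add {V : Matrix ι ι ℝ} (hV : V.PosDef) {R : Matrix κ κ ℝ}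
    (hR : R.PosDef) (C : Matrix κ ι ℝ) : (V⁻¹ + Cᵀ * R⁻¹ * C).PosDef :=
  hV.inv.add_posSemidef (hR.inv.posSemidef.conjTranspose_mul_mul_same C)

/-- The posterior precision intertwines the gain matrix. -/
lemma inv_add_mul_gain {V : Matrix ι ι ℝ} (hV : V.PosDef) {R : Matrix κ κ ℝ}
    (hR : R.PosDef) (C : Matrix κ ι ℝ) :
    (V⁻¹ + Cᵀ * R⁻¹ * C) * (V * Cᵀ * (C * V * Cᵀ + R)⁻¹) = Cᵀ * R⁻¹ := by
  have hVu := (isUnit_iff_isUnit_det _).mp hV.isUnit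
  have hRu := (isUnit_iff_isUnit_det _).mp hR.isUnit
  have hKu := (isUnit_iff_isUnit_det _).mp (posDef_mul_mul_transpose_add hV hR C).isUnit
  have h : (V⁻¹ + Cᵀ * R⁻¹ * C) * (V * Cᵀ) = Cᵀ * R⁻¹ * (C * V * Cᵀ + R) := by
    rw [Matrix.add_mul, nonsing_inv_mul_cancel_left _ _ hVu, Matrix.mul_add,
      nonsing_inv_mul_cancel_right _ _ hRu, add_comm]
    simp only [Matrix.mul_assoc]
  rw [← Matrix.mul_assoc, h, mul_nonsing_inv_cancel_right _ _ hKu]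

/-- The Woodbury identity for the posterior covariance matrix. -/
lemma inv_add_inv_eq {V : Matrix ι ι ℝ} (hV : V.PosDef) {R : Matrix κ κ ℝ}
    (hR : R.PosDef) (C : Matrix κ ι ℝ) :
    (V⁻¹ + Cᵀ * R⁻¹ * C)⁻¹ = V - V * Cᵀ * (C * V * Cᵀ + R)⁻¹ * C * V := by
  have hVu := (isUnit_iff_isUnit_det _).mp hV.isUnit
  refine inv_eq_right_inv ?_
  have h := inv_add_mul_gain hV hR C
  rw [Matrix.mul_sub, Matrix.mul_assoc _ C V, ← Matrix.mul_assoc _ _ (C * V), h, Matrix.add_mul,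
    nonsing_inv_mul _ hVu, ← Matrix.mul_assoc, add_sub_cancel_right]

lemma posDef_conditional {V : Matrix ι ι ℝ} (hV : V.PosDef) {R : Matrix κ κ ℝ}
    (hR : R.PosDef) (C : Matrix κ ι ℝ) :
    (V - V * Cᵀ * (C * V * Cᵀ + R)⁻¹ * C * V).PosDef := by
  rw [← inv_add_inv_eq hV hR]
  exact (posDef_inv_add hV hR C).inv

/-- Matches the normalizing constants in `normalPdf_mul_normalPdf`; it comes from det(1 + AB) =
det(1 + BA) and the Woodbury identity. -/
lemma det_mul_det_eq {V : Matrix ι ι ℝ} (hV : V.PosDef) {R : Matrix κ κ ℝ}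
    (hR : R.PosDef) (C : Matrix κ ι ℝ) :
    V.det * R.det =
      (C * V * Cᵀ + R).det * (V - V * Cᵀ * (C * V * Cᵀ + R)⁻¹ * C * V).det := by
  have hVu := (isUnit_iff_isUnit_det _).mp hV.isUnit
  have hRu := (isUnit_iff_isUnit_det _).mp hR.isUnit
  have h1 : (C * V * Cᵀ + R).det = R.det * (V.det * (V⁻¹ + Cᵀ * R⁻¹ * C).det) := by
    have e1 : C * V * Cᵀ + R = R * (1 + R⁻¹ * C * (V * Cᵀ)) := by
      rw [Matrix.mul_add, Matrix.mul_one, Matrix.mul_assoc R⁻¹,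
        mul_nonsing_inv_cancel_left _ _ hRu, add_comm, Matrix.mul_assoc]
    have e2 : V * (V⁻¹ + Cᵀ * R⁻¹ * C) = 1 + V * Cᵀ * (R⁻¹ * C) := by
      rw [Matrix.mul_add, mul_nonsing_inv _ hVu]
      simp only [Matrix.mul_assoc]
    rw [e1, det_mul, det_one_add_mul_comm, ← e2, det_mul]
  rw [h1, ← inv_add_inv_eq hV hR, det_nonsing_inv, Ring.inverse_eq_inv']
  have := (posDef_inv_add hV hR C).det_pos.ne'
  field_simp

omit [DecidableEq ι] in
lemma dotProduct_mulVec_comm {A : Matrix ι ι ℝ} (hA : A.IsHermitian) (u v : ι → ℝ) :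
    u ⬝ᵥ (A *ᵥ v) = v ⬝ᵥ (A *ᵥ u) := by
  have hT : Aᵀ = A := hA
  rw [dotProduct_mulVec, ← mulVec_transpose, hT, dotProduct_comm]

/-- With posterior precision Q and c the gain applied to y, expand both sides. The cross terms agree
because Qc = CᵀR⁻¹y, and the terms in y alone because cᵀQc = yᵀR⁻¹y - yᵀK⁻¹y. -/
lemma quadratic_form_complete_square {V : Matrix ι ι ℝ} (hV : V.PosDef) {R : Matrix κ κ ℝ}
    (hR : R.PosDef) (C : Matrix κ ι ℝ) (x : ι → ℝ) (y : κ → ℝ) :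
    x ⬝ᵥ (V⁻¹ *ᵥ x) + (y - C *ᵥ x) ⬝ᵥ (R⁻¹ *ᵥ (y - C *ᵥ x)) =
      y ⬝ᵥ ((C * V * Cᵀ + R)⁻¹ *ᵥ y) +
        (x - (V * Cᵀ * (C * V * Cᵀ + R)⁻¹) *ᵥ y) ⬝ᵥ
          ((V - V * Cᵀ * (C * V * Cᵀ + R)⁻¹ * C * V)⁻¹ *ᵥ
            (x - (V * Cᵀ * (C * V * Cᵀ + R)⁻¹) *ᵥ y)) := by
  have hRu := (isUnit_iff_isUnit_det _).mp hR.isUnit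
  have hK := posDef_mul_mul_transpose_add hV hR C
  have hKu := (isUnit_iff_isUnit_det _).mp hK.isUnit
  have hQ := posDef_inv_add hV hR C
  have hgain := inv_add_mul_gain hV hR C
  have adj : ∀ (u : ι → ℝ) (v : κ → ℝ), u ⬝ᵥ (Cᵀ *ᵥ v) = (C *ᵥ u) ⬝ᵥ v := by
    intro u v
    rw [dotProduct_mulVec, vecMul_transpose]
  rw [← inv_add_inv_eq hV hR, nonsing_inv_nonsing_inv _ ((isUnit_iff_isUnit_det _).mp hQ.isUnit)]
  set K := C * V * Cᵀ + R with hKdef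
  set Q := V⁻¹ + Cᵀ * R⁻¹ * C with hQdef
  set c := (V * Cᵀ * K⁻¹) *ᵥ y with hc
  have hQc : Q *ᵥ c = Cᵀ *ᵥ (R⁻¹ *ᵥ y) := by
    rw [hc, mulVec_mulVec, hgain, mulVec_mulVec]
  have hQx : x ⬝ᵥ (Q *ᵥ x) = x ⬝ᵥ (V⁻¹ *ᵥ x) + (C *ᵥ x) ⬝ᵥ (R⁻¹ *ᵥ (C *ᵥ x)) := by
    rw [hQdef, add_mulVec, dotProduct_add, ← mulVec_mulVec, ← mulVec_mulVec, adj]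
  have hCc : C *ᵥ c = y - R *ᵥ (K⁻¹ *ᵥ y) := by
    have e : C * (V * Cᵀ * K⁻¹) = 1 - R * K⁻¹ := by
      rw [eq_sub_iff_add_eq, ← Matrix.mul_assoc, ← Matrix.mul_assoc, ← Matrix.add_mul, ← hKdef,
        mul_nonsing_inv _ hKu]
    rw [hc, mulVec_mulVec, e, sub_mulVec, one_mulVec, mulVec_mulVec]
  have hcg : c ⬝ᵥ (Q *ᵥ c) = y ⬝ᵥ (R⁻¹ *ᵥ y) - y ⬝ᵥ (K⁻¹ *ᵥ y) := by
    rw [hQc, adj, hCc, sub_dotProduct, dotProduct_mulVec_comm hR.inv.isHermitian (R *ᵥ _), mulVec_mulVec,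
      nonsing_inv_mul _ hRu, one_mulVec]
  have hxc : x ⬝ᵥ (Q *ᵥ c) = (C *ᵥ x) ⬝ᵥ (R⁻¹ *ᵥ y) := by rw [hQc, adj]
  simp only [mulVec_sub, dotProduct_sub, sub_dotProduct]
  rw [dotProduct_mulVec_comm hQ.isHermitian c x, hQx, hcg, hxc, dotProduct_mulVec_comm hR.inv.isHermitian y (C *ᵥ x)]
  ring

/-- The product of a normal prior density and a normal likelihood is the marginal density of the
observation times the posterior density. -/
lemma normalPdf_mul_normalPdf {V : Matrix ι ι ℝ} (hV : V.PosDef) {R : Matrix κ κ ℝ}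
    (hR : R.PosDef) (C : Matrix κ ι ℝ) (x : ι → ℝ) (y : κ → ℝ) :
    normalPdf V x * normalPdf R (y - C *ᵥ x) =
      normalPdf (C * V * Cᵀ + R) y *
        normalPdf (V - V * Cᵀ * (C * V * Cᵀ + R)⁻¹ * C * V)
          (x - (V * Cᵀ * (C * V * Cᵀ + R)⁻¹) *ᵥ y) := by
  have hK := posDef_mul_mul_transpose_add hV hR C
  unfold normalPdf
  rw [mul_mul_mul_comm (Real.sqrt _)⁻¹, ← Real.exp_add, ← mul_inv,
    mul_mul_mul_comm (Real.sqrt _)⁻¹, ← Real.exp_add, ← mul_inv,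
    ← Real.sqrt_mul (mul_nonneg (by positivity) hV.det_pos.le),
    ← Real.sqrt_mul (mul_nonneg (by positivity) hK.det_pos.le), ← add_div, ← add_div, ← neg_add,
    ← neg_add, quadratic_form_complete_square hV hR C x y, mul_mul_mul_comm (_ ^ _),
    det_mul_det_eq hV hR C, mul_comm ((2 * Real.pi) ^ Fintype.card ι), mul_mul_mul_comm (_ ^ _)]

/-- Averaging a normal distribution function over a normally distributed shift of its argument. -/
lemma integral_normalPdf_mul_normalCdf {V : Matrix ι ι ℝ} (hV : V.PosDef) {M : Matrix κ κ ℝ}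
    (hM : M.PosDef) (B : Matrix κ ι ℝ) (a : κ → ℝ) :
    ∫ z, normalPdf V z * normalCdf M (a + B *ᵥ z) = normalCdf (B * V * Bᵀ + M) a := by
  -- Translating by Bz frees the domain of integration from z, which makes Fubini applicable.
  have hcdf : ∀ z, normalCdf M (a + B *ᵥ z) = ∫ t in Set.Iic a, normalPdf M (t + B *ᵥ z) := by
    intro z
    rw [normalCdf, ← (measurePreserving_add_right volume (B *ᵥ z)).setIntegral_preimage_emb
      (measurableEmbedding_addRight _)]
    congr 2
    ext t
    simp
  -- Conjugacy with observation matrix -B: after the swap, the inner integral over z is that of a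
  -- translated normal density, hence 1.
  have hpdf : ∀ z t, normalPdf V z * normalPdf M (t + B *ᵥ z) =
      normalPdf (B * V * Bᵀ + M) t * normalPdf (V - V * Bᵀ * (B * V * Bᵀ + M)⁻¹ * B * V)
          (z + (V * Bᵀ * (B * V * Bᵀ + M)⁻¹) *ᵥ t) := by
    intro z t
    have := normalPdf_mul_normalPdf hV hM (-B) z t
    simpa [neg_mulVec, Matrix.neg_mul, Matrix.mul_neg, sub_neg_eq_add] using this
  have hint : Integrable (fun p : (ι → ℝ) × (κ → ℝ) =>
      normalPdf V p.1 * normalPdf M (p.2 + B *ᵥ p.1)) (volume.prod volume) := by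
    have hcont : Continuous (fun p : (ι → ℝ) × (κ → ℝ) =>
        normalPdf V p.1 * normalPdf M (p.2 + B *ᵥ p.1)) :=
      ((continuous_normalPdf V).comp continuous_fst).mul
        ((continuous_normalPdf M).comp (by fun_prop))
    obtain ⟨hMi, hMv⟩ := integrable_and_integral_normalPdf hM
    rw [integrable_prod_iff hcont.aestronglyMeasurable]
    refine ⟨.of_forall fun z => (hMi.comp_add_right (B *ᵥ z)).const_mul (normalPdf V z), ?_⟩
    simp only [Real.norm_of_nonneg (mul_nonneg (normalPdf_nonneg V _) (normalPdf_nonneg M _)),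
      integral_const_mul, integral_add_right_eq_self (normalPdf M), hMv, mul_one]
    exact (integrable_and_integral_normalPdf hV).1
  simp only [hcdf, ← integral_const_mul]
  rw [integral_integral_swap]
  · simp only [hpdf, integral_const_mul]
    rw [normalCdf]
    congr 1
    funext t
    rw [integral_add_right_eq_self,
      (integrable_and_integral_normalPdf (posDef_conditional hV hM B)).2, mul_one]
  · refine hint.mono_measure ?_
    exact Measure.prod_mono le_rfl Measure.restrict_le_self

end Conditioning

/-! ### Correlation matrices and Schur complements -/

section Scale

variable {ι κ : Type*} [Fintype ι] [DecidableEq ι]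

omit [Fintype ι] in
lemma transpose_scaleDiag (Ω : Matrix ι ι ℝ) : (scaleDiag Ω)ᵀ = scaleDiag Ω :=
  diagonal_transpose _

lemma isUnit_det_scaleDiag {Ω : Matrix ι ι ℝ} (hΩ : Ω.PosDef) : IsUnit (scaleDiag Ω).det := by
  rw [scaleDiag, det_diagonal, isUnit_iff_ne_zero]
  exact Finset.prod_ne_zero_iff.mpr fun i _ => (Real.sqrt_pos.mpr hΩ.diag_pos).ne'

lemma corr_inv {Ω : Matrix ι ι ℝ} (hΩ : Ω.PosDef) :
    (corr Ω)⁻¹ = scaleDiag Ω * Ω⁻¹ * scaleDiag Ω := by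
  rw [corr, Matrix.mul_inv_rev, Matrix.mul_inv_rev, nonsing_inv_nonsing_inv _ (isUnit_det_scaleDiag hΩ),
    Matrix.mul_assoc]

lemma posDef_of_posDef_corr {Ω : Matrix ι ι ℝ} (h : (corr Ω).PosDef) : Ω.PosDef := by
  -- Were D_Ω singular, its inverse would have determinant 0 by convention, and so would the
  -- correlation matrix.
  have hD : IsUnit (scaleDiag Ω).det := by
    have h0 := h.det_pos.ne'
    rw [corr, det_mul, det_nonsing_inv, Ring.inverse_eq_inv'] at h0
    rw [isUnit_iff_ne_zero]
    intro hD
    simp [hD] at h0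
  have hΩ : Ω = scaleDiag Ω * corr Ω * (scaleDiag Ω)ᴴ := by
    rw [conjTranspose_eq_transpose_of_trivial, transpose_scaleDiag, corr, Matrix.mul_assoc _ Ω,
      mul_nonsing_inv_cancel_left _ _ hD, nonsing_inv_mul_cancel_right _ _ hD]
  rw [hΩ]
  exact h.mul_mul_conjTranspose_same
    (vecMul_injective_iff_isUnit.mpr ((isUnit_iff_isUnit_det _).mpr hD))

omit [Fintype ι] [DecidableEq ι] in
lemma posDef_lower_right {Γ : Matrix κ κ ℝ} {Δ : Matrix ι κ ℝ} {A : Matrix ι ι ℝ}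
    (h : (fromBlocks Γ Δᵀ Δ A).PosDef) : A.PosDef :=
  h.submatrix (e := Sum.inr) Sum.inr_injective

/-- The block criterion gives semidefiniteness; the determinant factorization excludes a zero
determinant. -/
lemma posDef_schur_complement [Fintype κ] [DecidableEq κ] {Γ : Matrix κ κ ℝ} {Δ : Matrix ι κ ℝ}
    {A : Matrix ι ι ℝ} (h : (fromBlocks Γ Δᵀ Δ A).PosDef) : (Γ - Δᵀ * A⁻¹ * Δ).PosDef := by
  have hA := posDef_lower_right h
  let := hA.isUnit.invertible
  have hs : (Γ - Δᵀ * A⁻¹ * Δ).PosSemidef :=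
    (PosDef.fromBlocks₂₂ Γ Δᵀ hA).mp h.posSemidef
  have hdet := h.det_pos.ne'
  rw [det_fromBlocks₂₂, invOf_eq_nonsing_inv] at hdet
  exact hs.posDef_iff_det_ne_zero.mpr (right_ne_zero_of_mul hdet)

end Scale

/-! ### Posterior parameters and the integral against the prior density -/

section Params

variable {n s mr ma : ℕ} {Ω : Matrix (Fin n) (Fin n) ℝ} (hΩ : Ω.PosDef)
  (Δ : Matrix (Fin n) (Fin s) ℝ) (W : Matrix (Fin ma) (Fin n) ℝ)

include hΩ

/-- The second block of Δ_* is chosen so that the correlation and scale factors cancel, leaving W.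
-/
lemma transpose_augSkew_mul_inv :
    (augSkew Ω Δ W)ᵀ * (corr Ω)⁻¹ * (scaleDiag Ω)⁻¹ =
      fromRows (Δᵀ * (corr Ω)⁻¹ * (scaleDiag Ω)⁻¹) W := by
  have hD := isUnit_det_scaleDiag hΩ
  have hΩu := (isUnit_iff_isUnit_det _).mp hΩ.isUnit
  have hT : Ωᵀ = Ω := hΩ.isHermitian
  rw [augSkew, transpose_fromCols, fromRows_mul, fromRows_mul, transpose_mul, transpose_transpose,
    transpose_mul, transpose_nonsing_inv, transpose_scaleDiag, hT]
  congr 1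
  rw [corr_inv hΩ, ← Matrix.mul_assoc, mul_nonsing_inv_cancel_right _ _ hD]
  simp only [← Matrix.mul_assoc]
  rw [nonsing_inv_mul_cancel_right _ _ hD, mul_nonsing_inv_cancel_right _ _ hΩu]

/-- The off-diagonal blocks and WΩWᵀ of Γ_p are exactly the terms removed, so the two distribution
functions decouple. -/
lemma affineGammaMat_sub (Γ : Matrix (Fin s) (Fin s) ℝ) (S : Matrix (Fin ma) (Fin ma) ℝ) :
    affineGammaMat Ω Δ Γ W S - (augSkew Ω Δ W)ᵀ * (corr Ω)⁻¹ * augSkew Ω Δ W =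
      fromBlocks (Γ - Δᵀ * (corr Ω)⁻¹ * Δ) 0 0 S := by
  have hD := isUnit_det_scaleDiag hΩ
  have hΩu := (isUnit_iff_isUnit_det _).mp hΩ.isUnit
  have hT : Ωᵀ = Ω := hΩ.isHermitian
  have h1 : Δᵀ * (corr Ω)⁻¹ * ((scaleDiag Ω)⁻¹ * Ω * Wᵀ) = Δᵀ * scaleDiag Ω * Wᵀ := by
    rw [corr_inv hΩ]
    simp only [← Matrix.mul_assoc]
    rw [mul_nonsing_inv_cancel_right _ _ hD, nonsing_inv_mul_cancel_right _ _ hΩu]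
  have h2 : ((scaleDiag Ω)⁻¹ * Ω * Wᵀ)ᵀ * (corr Ω)⁻¹ = W * scaleDiag Ω := by
    rw [corr_inv hΩ, transpose_mul, transpose_transpose, transpose_mul, transpose_nonsing_inv,
      transpose_scaleDiag, hT]
    simp only [← Matrix.mul_assoc]
    rw [nonsing_inv_mul_cancel_right _ _ hD, mul_nonsing_inv_cancel_right _ _ hΩu]
  have h3 : W * scaleDiag Ω * ((scaleDiag Ω)⁻¹ * Ω * Wᵀ) = W * Ω * Wᵀ := by
    simp only [← Matrix.mul_assoc]
    rw [mul_nonsing_inv_cancel_right _ _ hD]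
  rw [affineGammaMat, augSkew, transpose_fromCols, fromRows_mul, fromRows_mul_fromCols, h1, h2, h3,
    sub_eq_add_neg, fromBlocks_neg, fromBlocks_add]
  simp [← sub_eq_add_neg]

/-- Writing B = Δ_*ᵀΩ̄⁻¹D_Ω⁻¹, one has Δ_p = D_Ω̃⁻¹Ω̃Bᵀ, and the scale factors of Ω̃ cancel in the
product. -/
lemma transpose_postSkew_mul_mul (C : Matrix (Fin mr) (Fin n) ℝ) {R : Matrix (Fin mr) (Fin mr) ℝ}
    (hR : R.PosDef) :
    (postSkew Ω Δ C R W)ᵀ * (corr (postScale Ω C R))⁻¹ * postSkew Ω Δ C R W =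
      (augSkew Ω Δ W)ᵀ * (corr Ω)⁻¹ * (scaleDiag Ω)⁻¹ * postScale Ω C R *
        ((augSkew Ω Δ W)ᵀ * (corr Ω)⁻¹ * (scaleDiag Ω)⁻¹)ᵀ := by
  have hV : (postScale Ω C R).PosDef := posDef_conditional hΩ hR C
  set V := postScale Ω C R with hVdef
  have hDV := isUnit_det_scaleDiag hV
  have hVu := (isUnit_iff_isUnit_det _).mp hV.isUnit
  have hVT : Vᵀ = V := hV.isHermitian
  have hT : Ωᵀ = Ω := hΩ.isHermitian
  have hcT : ((corr Ω)⁻¹)ᵀ = (corr Ω)⁻¹ := by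
    rw [corr_inv hΩ, transpose_mul, transpose_mul, transpose_nonsing_inv, transpose_scaleDiag, hT,
      Matrix.mul_assoc]
  have h : postSkew Ω Δ C R W = (scaleDiag V)⁻¹ * V *
      ((augSkew Ω Δ W)ᵀ * (corr Ω)⁻¹ * (scaleDiag Ω)⁻¹)ᵀ := by
    rw [postSkew, ← hVdef, corr, nonsing_inv_mul_cancel_right _ _ hDV, transpose_mul, transpose_mul,
      transpose_nonsing_inv, transpose_scaleDiag, hcT, transpose_transpose]
    simp only [Matrix.mul_assoc]
  rw [h, corr_inv hV, transpose_mul, transpose_transpose, transpose_mul, transpose_nonsing_inv,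
    transpose_scaleDiag, hVT]
  generalize (augSkew Ω Δ W)ᵀ * (corr Ω)⁻¹ * (scaleDiag Ω)⁻¹ = B
  simp only [← Matrix.mul_assoc]
  rw [nonsing_inv_mul_cancel_right _ _ hDV, mul_nonsing_inv_cancel_right _ _ hDV,
    mul_nonsing_inv_cancel_right _ _ hVu]

lemma postGammaMat_eq (Γ : Matrix (Fin s) (Fin s) ℝ) (S : Matrix (Fin ma) (Fin ma) ℝ)
    (C : Matrix (Fin mr) (Fin n) ℝ) {R : Matrix (Fin mr) (Fin mr) ℝ} (hR : R.PosDef) :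
    postGammaMat Ω Δ Γ C R W S =
      fromRows (Δᵀ * (corr Ω)⁻¹ * (scaleDiag Ω)⁻¹) W * postScale Ω C R *
          (fromRows (Δᵀ * (corr Ω)⁻¹ * (scaleDiag Ω)⁻¹) W)ᵀ +
        fromBlocks (Γ - Δᵀ * (corr Ω)⁻¹ * Δ) 0 0 S := by
  rw [postGammaMat, affineGammaMat_sub hΩ, transpose_postSkew_mul_mul hΩ Δ W C hR,
    transpose_augSkew_mul_inv hΩ, add_comm]

/-- The product of the prior density and the mixed likelihood, in terms of the posterior
parameters. -/
lemma sunPdf_mul_mixedLikelihood {Γ : Matrix (Fin s) (Fin s) ℝ} {S : Matrix (Fin ma) (Fin ma) ℝ}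
    (hM : (Γ - Δᵀ * (corr Ω)⁻¹ * Δ).PosDef) (hS : S.PosDef)
    (C : Matrix (Fin mr) (Fin n) ℝ) {R : Matrix (Fin mr) (Fin mr) ℝ} (hR : R.PosDef)
    (ξ : Fin n → ℝ) (γ : Fin s → ℝ) (Y : Fin mr → ℝ) (Z : Fin ma → ℝ) (z : Fin n → ℝ) :
    sunPdf ξ Ω Δ γ Γ z * mixedLikelihood C R Y W Z S z =
      normalPdf (C * Ω * Cᵀ + R) (Y - C *ᵥ ξ) / normalCdf Γ γ *
        (normalPdf (postScale Ω C R) (z - postLoc ξ Ω C R Y) *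
          normalCdf (fromBlocks (Γ - Δᵀ * (corr Ω)⁻¹ * Δ) 0 0 S)
            (postGammaVec ξ Ω Δ γ C R Y W Z +
              fromRows (Δᵀ * (corr Ω)⁻¹ * (scaleDiag Ω)⁻¹) W *ᵥ (z - postLoc ξ Ω C R Y))) := by
  -- The shift by ξ̃ - ξ inside γ̃ recentres the argument from ξ̃ to ξ.
  have hvec : postGammaVec ξ Ω Δ γ C R Y W Z +
      fromRows (Δᵀ * (corr Ω)⁻¹ * (scaleDiag Ω)⁻¹) W *ᵥ (z - postLoc ξ Ω C R Y) =
      Sum.elim (γ + (Δᵀ * (corr Ω)⁻¹ * (scaleDiag Ω)⁻¹) *ᵥ (z - ξ)) (Z + W *ᵥ z) := by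
    rw [postGammaVec, transpose_augSkew_mul_inv hΩ, add_assoc, ← mulVec_add, add_comm (_ - ξ),
      sub_add_sub_cancel, affineGammaVec, fromRows_mulVec]
    ext (i | i)
    · rfl
    · simp [mulVec_sub]
  have hY : Y - C *ᵥ z = Y - C *ᵥ ξ - C *ᵥ (z - ξ) := by
    rw [mulVec_sub]; abel
  have hloc : z - postLoc ξ Ω C R Y =
      z - ξ - (Ω * Cᵀ * (C * Ω * Cᵀ + R)⁻¹) *ᵥ (Y - C *ᵥ ξ) := by
    rw [postLoc, sub_sub]
  have hpdf := normalPdf_mul_normalPdf hΩ hR C (z - ξ) (Y - C *ᵥ ξ)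
  rw [← hY, ← hloc] at hpdf
  rw [hvec, normalCdf_fromBlocks _ _ hM hS, sunPdf, mixedLikelihood]
  change _ = _ * (normalPdf (Ω - Ω * Cᵀ * (C * Ω * Cᵀ + R)⁻¹ * C * Ω) _ * _)
  -- Φ(γ; Γ) is a common divisor of both sides, so its positivity plays no role.
  linear_combination (normalCdf (Γ - Δᵀ * (corr Ω)⁻¹ * Δ)
    (γ + (Δᵀ * (corr Ω)⁻¹ * (scaleDiag Ω)⁻¹) *ᵥ (z - ξ)) * normalCdf S (Z + W *ᵥ z) /
      normalCdf Γ γ) * hpdf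

lemma integral_sunPdf_mul_mixedLikelihood {Γ : Matrix (Fin s) (Fin s) ℝ}
    {S : Matrix (Fin ma) (Fin ma) ℝ} (hM : (Γ - Δᵀ * (corr Ω)⁻¹ * Δ).PosDef) (hS : S.PosDef)
    (C : Matrix (Fin mr) (Fin n) ℝ) {R : Matrix (Fin mr) (Fin mr) ℝ} (hR : R.PosDef)
    (ξ : Fin n → ℝ) (γ : Fin s → ℝ) (Y : Fin mr → ℝ) (Z : Fin ma → ℝ) :
    ∫ z, sunPdf ξ Ω Δ γ Γ z * mixedLikelihood C R Y W Z S z =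
      normalPdf (C * Ω * Cᵀ + R) (Y - C *ᵥ ξ) *
        (normalCdf (postGammaMat Ω Δ Γ C R W S) (postGammaVec ξ Ω Δ γ C R Y W Z) /
          normalCdf Γ γ) := by
  have hblock : (fromBlocks (Γ - Δᵀ * (corr Ω)⁻¹ * Δ) 0 0 S).PosDef := by
    let := hM.isUnit.invertible
    have hs := (PosDef.fromBlocks₁₁ (0 : Matrix (Fin s) (Fin ma) ℝ) S hM).mpr
      (by simpa using hS.posSemidef)
    rw [conjTranspose_zero] at hs
    refine hs.posDef_iff_det_ne_zero.mpr ?_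
    rw [det_fromBlocks_zero₂₁]
    exact mul_ne_zero hM.det_pos.ne' hS.det_pos.ne'
  simp only [sunPdf_mul_mixedLikelihood hΩ Δ W hM hS C hR]
  rw [integral_const_mul, integral_sub_right_eq_self (fun w => normalPdf (postScale Ω C R) w *
      normalCdf (fromBlocks (Γ - Δᵀ * (corr Ω)⁻¹ * Δ) 0 0 S) (postGammaVec ξ Ω Δ γ C R Y W Z +
        fromRows (Δᵀ * (corr Ω)⁻¹ * (scaleDiag Ω)⁻¹) W *ᵥ w)),
    integral_normalPdf_mul_normalCdf (V := postScale Ω C R) (posDef_conditional hΩ hR C) hblock,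
    postGammaMat_eq hΩ Δ W Γ S C hR]
  ring

end Params

/-! ### Measurability and boundedness of the likelihood -/

section Likelihood

variable {n s mr ma : ℕ}

lemma measurable_sunPdf (ξ : Fin n → ℝ) (Ω : Matrix (Fin n) (Fin n) ℝ)
    (Δ : Matrix (Fin n) (Fin s) ℝ) (γ : Fin s → ℝ) (Γ : Matrix (Fin s) (Fin s) ℝ) :
    Measurable (sunPdf ξ Ω Δ γ Γ) := by
  have h1 : Measurable fun z : Fin n → ℝ => z - ξ := by fun_prop
  have h2 : Measurable fun z : Fin n → ℝ =>
      γ + (Δᵀ * (corr Ω)⁻¹ * (scaleDiag Ω)⁻¹) *ᵥ (z - ξ) :=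
    Continuous.measurable (by fun_prop)
  exact ((continuous_normalPdf Ω).measurable.comp h1).mul
    (((measurable_normalCdf _).comp h2).div_const _)

lemma sunPdf_nonneg (ξ : Fin n → ℝ) (Ω : Matrix (Fin n) (Fin n) ℝ)
    (Δ : Matrix (Fin n) (Fin s) ℝ) (γ : Fin s → ℝ) (Γ : Matrix (Fin s) (Fin s) ℝ)
    (z : Fin n → ℝ) : 0 ≤ sunPdf ξ Ω Δ γ Γ z :=
  mul_nonneg (normalPdf_nonneg _ _) (div_nonneg (normalCdf_nonneg _ _) (normalCdf_nonneg _ _))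

lemma measurable_mixedLikelihood (C : Matrix (Fin mr) (Fin n) ℝ) (R : Matrix (Fin mr) (Fin mr) ℝ)
    (Y : Fin mr → ℝ) (W : Matrix (Fin ma) (Fin n) ℝ) (Z : Fin ma → ℝ)
    (S : Matrix (Fin ma) (Fin ma) ℝ) : Measurable (mixedLikelihood C R Y W Z S) := by
  have h1 : Measurable fun v : Fin n → ℝ => Z + W *ᵥ v := Continuous.measurable (by fun_prop)
  have h2 : Measurable fun v : Fin n → ℝ => Y - C *ᵥ v := Continuous.measurable (by fun_prop)
  exact ((measurable_normalCdf S).comp h1).mul ((continuous_normalPdf R).measurable.comp h2)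

/-- A uniform bound suffices for integrability, since the prior is a probability measure. -/
lemma norm_mixedLikelihood_le (C : Matrix (Fin mr) (Fin n) ℝ) {R : Matrix (Fin mr) (Fin mr) ℝ}
    (hR : R.PosDef) (Y : Fin mr → ℝ) (W : Matrix (Fin ma) (Fin n) ℝ) (Z : Fin ma → ℝ)
    {S : Matrix (Fin ma) (Fin ma) ℝ} (hS : S.PosDef) (v : Fin n → ℝ) :
    ‖mixedLikelihood C R Y W Z S v‖ ≤
      (Real.sqrt ((2 * Real.pi) ^ Fintype.card (Fin mr) * R.det))⁻¹ := by
  rw [mixedLikelihood, Real.norm_of_nonneg (mul_nonneg (normalCdf_nonneg _ _)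
    (normalPdf_nonneg _ _))]
  exact (mul_le_of_le_one_left (normalPdf_nonneg _ _) (normalCdf_le_one hS _)).trans
    (normalPdf_le hR _)

end Likelihood

end SkewGP

theorem corollary3 {d s n mr ma : ℕ}
    {Θ : Type*} [MeasurableSpace Θ] (P : Measure Θ) [IsProbabilityMeasure P]
    (f : EuclideanSpace ℝ (Fin d) → Θ → ℝ)
    (ξ : EuclideanSpace ℝ (Fin d) → ℝ)
    (Ω : EuclideanSpace ℝ (Fin d) → EuclideanSpace ℝ (Fin d) → ℝ)
    (Δ : EuclideanSpace ℝ (Fin d) → Fin s → ℝ)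
    (γ : Fin s → ℝ) (Γ : Matrix (Fin s) (Fin s) ℝ)
    (hf : SkewGP.IsSkewGP P f ξ Ω Δ γ Γ)
    (X : Fin n → EuclideanSpace ℝ (Fin d)) (hX : Function.Injective X)
    (C : Matrix (Fin mr) (Fin n) ℝ) (R : Matrix (Fin mr) (Fin mr) ℝ) (hR : R.PosDef)
    (Y : Fin mr → ℝ)
    (W : Matrix (Fin ma) (Fin n) ℝ) (Z : Fin ma → ℝ)
    (S : Matrix (Fin ma) (Fin ma) ℝ) (hS : S.PosDef) :
    Integrable (fun θ => SkewGP.mixedLikelihood C R Y W Z S (fun i => f (X i) θ)) P ∧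
    SkewGP.marginalLikelihood P f X (SkewGP.mixedLikelihood C R Y W Z S) =
      SkewGP.normalPdf (C * SkewGP.scaleMat Ω X * Cᵀ + R) (Y - C *ᵥ SkewGP.locVec ξ X) *
        (SkewGP.normalCdf
            (SkewGP.postGammaMat (SkewGP.scaleMat Ω X) (SkewGP.skewMat Δ X) Γ C R W S)
            (SkewGP.postGammaVec (SkewGP.locVec ξ X) (SkewGP.scaleMat Ω X)
              (SkewGP.skewMat Δ X) γ C R Y W Z) /
          SkewGP.normalCdf Γ γ) := by
  have hblock := hf.posDef n X hX
  have hΩ := SkewGP.posDef_of_posDef_corr (SkewGP.posDef_lower_right hblock)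
  have hmeas : Measurable fun θ i => f (X i) θ := measurable_pi_lambda _ fun i => hf.measurable _
  have hL := SkewGP.measurable_mixedLikelihood C R Y W Z S
  refine ⟨Integrable.of_bound (hL.comp hmeas).aestronglyMeasurable _
    (.of_forall fun θ => SkewGP.norm_mixedLikelihood_le C hR Y W Z hS _), ?_⟩
  -- Transfer to the law of f(X), then to Lebesgue measure weighted by the prior density.
  rw [SkewGP.marginalLikelihood, ← integral_map hmeas.aemeasurable hL.aestronglyMeasurable,
    hf.law n X hX, SkewGP.sunMeasure, integral_withDensity_eq_integral_toReal_smul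
      (SkewGP.measurable_sunPdf _ _ _ _ _).ennreal_ofReal (.of_forall fun _ => ENNReal.ofReal_lt_top)]
  simp only [ENNReal.toReal_ofReal (SkewGP.sunPdf_nonneg _ _ _ _ _ _), smul_eq_mul]
  exact SkewGP.integral_sunPdf_mul_mixedLikelihood hΩ _ W
    (SkewGP.posDef_schur_complement hblock) hS C hR _ γ Y Z
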